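/- Let $\mathbb{F}_q$ be a finite field and let $F/\mathbb{F}_q$ be an algebraic function field of one variable (that is, $F$ is a finite extension of $\mathbb{F}_q(x)$ for some $x\in F$ transcendental over $\mathbb{F}_q$) whose full constant field is $\mathbb{F}_q$, i.e. every element of $F$ that is algebraic over $\mathbb{F}_q$ lies in $\mathbb{F}_q$. A place $P$ of $F/\mathbb{F}_q$ is the maximal ideal of a valuation ring $\mathcal{O}_P\subsetneq F$ of $F$ containing $\mathbb{F}_q$, and $v_P$ denotes the corresponding normalized discrete valuation. For a divisor $D=\sum_P D(P)\,P$ of $F/\mathbb{F}_q$ (an element of the free abelian group on the places) let $$\mathcal{L}(D)=\{f\in F : f=0 \text{ or } v_P(f)\ge -D(P) \text{ for all places } P\}$$ be its Riemann–Roch space. If $D_1$ and $D_2$ are effective divisors of $F/\mathbb{F}_q$ (all coefficients are nonnegative) with disjoint supports, then $$\mathcal{L}(D_1)\cap\mathcal{L}(D_2)=\mathbb{F}_q .$$ -/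

import Mathlib

open scoped IntermediateField WithZero

/-- `F / k` is an algebraic function field of one variable: `F` is a finite extension of `k(x)`
for some `x ∈ F` transcendental over `k`. -/
class IsAlgFunctionField (k F : Type*) [Field k] [Field F] [Algebra k F] : Prop where
  exists_transcendental : ∃ x : F, Transcendental k x ∧ FiniteDimensional k⟮x⟯ F

/-- A place of `F / k`, given by its valuation ring `𝒪`: a subring of `F` such that `z ∈ 𝒪` or
`z⁻¹ ∈ 𝒪` for every `z ∈ F`, which contains `k` and differs from `F`. The place in the narrow
sense is the maximal ideal of this ring; each of the two determines the other. -/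
@[ext]
structure Place (k F : Type*) [Field k] [Field F] [Algebra k F] where
  /-- The valuation ring of the place. -/
  valuationRing : ValuationSubring F
  algebraMap_mem : ∀ c : k, algebraMap k F c ∈ valuationRing
  ne_top : valuationRing ≠ ⊤

/-! ### The valuation ring of a place of a function field is a discrete valuation ring -/

section DVR

variable {k F : Type*} [Field k] [Field F] [Algebra k F]

theorem IsAlgFunctionField.finiteDimensional [IsAlgFunctionField k F] {x : F}
    (hx : Transcendental k x) : FiniteDimensional k⟮x⟯ F := by
  obtain ⟨x₀, hx₀, hfin⟩ := IsAlgFunctionField.exists_transcendental (k := k) (F := F)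
  have : Algebra.EssFiniteType k k⟮x₀⟯ := IntermediateField.essFiniteType_iff.mpr
    (IntermediateField.fg_adjoin_of_finite (Set.finite_singleton x₀))
  have : Algebra.EssFiniteType k F := Algebra.EssFiniteType.comp k k⟮x₀⟯ F
  have : Algebra.EssFiniteType k⟮x⟯ F := Algebra.EssFiniteType.of_comp k k⟮x⟯ F
  have htr : Algebra.trdeg k F ≤ 1 := by
    have h1 : Algebra.IsAlgebraic (Algebra.adjoin k {x₀}) F := by
      have h2 : Algebra.IsAlgebraic k⟮x₀⟯ F := inferInstance
      open scoped IntermediateField.algebraAdjoinAdjoin in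
      exact Algebra.IsAlgebraic.trans (Algebra.adjoin k {x₀}) k⟮x₀⟯ F
    simpa using Algebra.IsAlgebraic.trdeg_le_cardinalMk k ({x₀} : Set F)
  have halg : Algebra.IsAlgebraic k⟮x⟯ F := by
    have hind : AlgebraicIndependent k (Subtype.val : ({x} : Set F) → F) :=
      algebraicIndependent_unique_type_iff.mpr hx
    have hb := hind.isTranscendenceBasis_of_trdeg_le_of_finite (by simpa using htr)
    have := hb.isAlgebraic_field
    rwa [Subtype.range_coe] at this
  obtain ⟨s, hs⟩ := IntermediateField.fg_top k⟮x⟯ F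
  have : FiniteDimensional k⟮x⟯ (IntermediateField.adjoin k⟮x⟯ (s : Set F)) :=
    IntermediateField.finiteDimensional_adjoin
      fun y _ => (Algebra.IsAlgebraic.isAlgebraic y).isIntegral
  rw [hs] at this
  exact IntermediateField.topEquiv.toLinearEquiv.finiteDimensional

namespace Place

instance (P : Place k F) : Algebra k P.valuationRing :=
  ((algebraMap k F).codRestrict P.valuationRing.toSubring P.algebraMap_mem).toAlgebra

instance (P : Place k F) : IsScalarTower k P.valuationRing F :=
  IsScalarTower.of_algebraMap_eq fun _ => rfl

variable (P : Place k F)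

theorem transcendental {x : P.valuationRing} (hx0 : x ≠ 0) (hx : ¬ IsUnit x) :
    Transcendental k (x : F) := by
  intro halg
  apply hx
  have hx' : (x : F) ≠ 0 := by simpa using hx0
  have hinv : (x : F)⁻¹ ∈ P.valuationRing := by
    have h2 : (x : F)⁻¹ ∈ Algebra.adjoin k {(x : F)} := by
      have := halg.isIntegral.inv_mem_adjoin
      exact this
    have h3 : Algebra.adjoin k {(x : F)} ≤
        (IsScalarTower.toAlgHom k P.valuationRing F).range := by
      rw [Algebra.adjoin_le_iff]
      rintro _ rfl
      exact ⟨x, rfl⟩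
    obtain ⟨y, hy⟩ := h3 h2
    rw [← hy]
    exact y.2
  exact IsUnit.of_mul_eq_one ⟨_, hinv⟩ (Subtype.ext (mul_inv_cancel₀ hx'))

theorem eq_zero_of_sum_eq_zero {x : P.valuationRing} (hx0 : x ≠ 0) {ι : Type*} [Fintype ι]
    (b : ι → P.valuationRing)
    (hb : LinearIndependent k fun i => Ideal.Quotient.mk (Ideal.span {x}) (b i)) (n : ℕ) :
    ∀ p : ι → Polynomial k, (∀ i, ∀ m, n ≤ m → (p i).coeff m = 0) →
      ∑ i, Polynomial.aeval x (p i) * b i = 0 → ∀ i, p i = 0 := by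
  induction n with
  | zero =>
    intro p hp _ i
    ext m
    simpa using hp i m (Nat.zero_le m)
  | succ n ih =>
    intro p hp hsum
    have hdecomp : ∀ i, Polynomial.aeval x (p i) =
        x * Polynomial.aeval x (p i).divX + algebraMap k _ ((p i).coeff 0) := by
      intro i
      conv_lhs => rw [← Polynomial.X_mul_divX_add (p i)]
      rw [map_add, map_mul, Polynomial.aeval_X, Polynomial.aeval_C]
    have hzero : ∀ i, (p i).coeff 0 = 0 := by
      have h1 := congrArg (Ideal.Quotient.mk (Ideal.span {x})) hsum
      have hxz : Ideal.Quotient.mk (Ideal.span {x}) x = 0 :=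
        Ideal.Quotient.eq_zero_iff_mem.mpr (Ideal.mem_span_singleton_self x)
      refine Fintype.linearIndependent_iff.mp hb _ ?_
      rw [map_zero, map_sum] at h1
      rw [← h1]
      refine Finset.sum_congr rfl fun i _ => ?_
      rw [hdecomp i, map_mul, map_add, map_mul, hxz, zero_mul, zero_add, Algebra.smul_def]
      rfl
    have hdiv : ∀ i, (p i).divX = 0 := by
      refine ih (fun i => (p i).divX) (fun i m hm => ?_) ?_
      · rw [Polynomial.coeff_divX]
        exact hp i _ (by omega)
      · apply mul_left_cancel₀ hx0
        rw [mul_zero, ← hsum, Finset.mul_sum]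
        refine Finset.sum_congr rfl fun i _ => ?_
        rw [hdecomp i, hzero i, map_zero, add_zero, mul_assoc]
    intro i
    rw [← Polynomial.X_mul_divX_add (p i), hdiv i, hzero i]
    simp

open scoped IntermediateField.algebraAdjoinAdjoin in
theorem finite_quotient [IsAlgFunctionField k F] {x : P.valuationRing} (hx0 : x ≠ 0)
    (hx : ¬ IsUnit x) : Module.Finite k (P.valuationRing ⧸ Ideal.span {x}) := by
  have htr := P.transcendental hx0 hx
  have : FiniteDimensional k⟮(x : F)⟯ F := IsAlgFunctionField.finiteDimensional htr
  refine Module.rank_lt_aleph0_iff.mp (lt_of_le_of_lt (rank_le (n := Module.finrank k⟮(x : F)⟯ F)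
    fun s hs => ?_) (Cardinal.natCast_lt_aleph0))
  choose b hb using fun i : s => Ideal.Quotient.mk_surjective (I := Ideal.span {x}) i.1
  have hb' : LinearIndependent k fun i => Ideal.Quotient.mk (Ideal.span {x}) (b i) := by
    simpa only [hb] using hs
  have key : LinearIndependent (Algebra.adjoin k {(x : F)}) fun i => (b i : F) := by
    rw [Fintype.linearIndependent_iff]
    intro g hg
    have hg' : ∀ i, ∃ p : Polynomial k, Polynomial.aeval (x : F) p = g i := fun i =>
      (Algebra.adjoin_singleton_eq_range_aeval k (x : F)).le (g i).2
    choose p hp using hg'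
    have hz := P.eq_zero_of_sum_eq_zero hx0 b hb' (Finset.univ.sup (fun i => (p i).natDegree) + 1) p
      (fun i m hm => Polynomial.coeff_eq_zero_of_natDegree_lt
        (lt_of_le_of_lt (Finset.le_sup (f := fun i => (p i).natDegree) (Finset.mem_univ i)) hm)) (by
        apply Subtype.ext
        change algebraMap P.valuationRing F _ = 0
        rw [map_sum, ← hg]
        refine Finset.sum_congr rfl fun i _ => ?_
        rw [map_mul, ← Polynomial.aeval_algebraMap_apply, Algebra.smul_def]
        congr 1
        exact hp i)
    intro i
    apply Subtype.ext
    rw [← hp i, hz i]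
    simp
  have key2 := (LinearIndependent.iff_fractionRing (Algebra.adjoin k {(x : F)}) k⟮(x : F)⟯).mp key
  simpa using key2.fintype_card_le_finrank

instance isNoetherianRing [IsAlgFunctionField k F] : IsNoetherianRing P.valuationRing := by
  refine (isNoetherianRing_iff_ideal_fg _).mpr fun I => ?_
  by_cases hI : I = ⊥
  · subst hI
    exact Submodule.fg_bot
  by_cases hI' : I = ⊤
  · subst hI'
    exact ⟨{1}, by simp⟩
  obtain ⟨x, hxI, hx0⟩ := Submodule.exists_mem_ne_zero_of_ne_bot hI
  have hx : ¬ IsUnit x := fun h => hI' (Ideal.eq_top_of_isUnit_mem I hxI h)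
  have := P.finite_quotient hx0 hx
  have hN : IsNoetherian P.valuationRing (P.valuationRing ⧸ Ideal.span {x}) :=
    isNoetherian_of_tower k inferInstance
  refine Submodule.fg_of_fg_map_of_fg_inf_ker (Ideal.span {x}).mkQ (IsNoetherian.noetherian _) ?_
  rw [Submodule.ker_mkQ, inf_eq_right.mpr ((Ideal.span_singleton_le_iff_mem I).mpr hxI)]
  exact ⟨{x}, by simp⟩

theorem not_isField : ¬ IsField P.valuationRing := by
  intro h
  refine P.ne_top (top_le_iff.mp fun z _ => ?_)
  by_cases hz : z = 0
  · subst hz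
    exact P.valuationRing.zero_mem
  rcases P.valuationRing.mem_or_inv_mem z with h1 | h1
  · exact h1
  · obtain ⟨y, hy⟩ := h.mul_inv_cancel (a := ⟨z⁻¹, h1⟩) (by simpa [Subtype.ext_iff] using hz)
    have hy' : z⁻¹ * (y : F) = 1 := congrArg Subtype.val hy
    have : (y : F) = z := by field_simp at hy'; exact hy'
    rw [← this]
    exact y.2

instance isDiscreteValuationRing [IsAlgFunctionField k F] :
    IsDiscreteValuationRing P.valuationRing := by
  have : IsPrincipalIdealRing P.valuationRing := inferInstance
  exact { not_a_field' := fun h => P.not_isField (IsLocalRing.isField_iff_maximalIdeal_eq.mpr h) }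

end Place

end DVR

/-! ### Orders, divisors and Riemann–Roch spaces -/

section Divisors

variable (k F : Type*) [Field k] [Field F] [Algebra k F] [IsAlgFunctionField k F]

variable {k F} in
/-- The order `v_P(f)` at the place `P` of a nonzero function `f` (the value at `f = 0`, where
`v_P(0) = ∞`, is not meaningful): minus the logarithm of the multiplicative valuation of `F`
attached to the maximal ideal of the discrete valuation ring `𝒪_P`. -/
noncomputable def Place.ord (P : Place k F) (f : F) : ℤ :=
  - WithZero.log ((IsDiscreteValuationRing.maximalIdeal P.valuationRing).valuation F f)

/-- The divisors of `F / k`: the free abelian group on the places. A divisor `D` is effective if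
`0 ≤ D`, and its support `D.support` is the finite set of places with `D P ≠ 0`. -/
abbrev FunctionFieldDivisor : Type _ := Place k F →₀ ℤ

variable {k F}

theorem Place.neg_le_ord_iff (P : Place k F) {f : F} (hf : f ≠ 0) (n : ℤ) :
    -n ≤ P.ord f ↔
      (IsDiscreteValuationRing.maximalIdeal P.valuationRing).valuation F f ≤ WithZero.exp n := by
  rw [Place.ord, neg_le_neg_iff, WithZero.log_le_iff_le_exp (by simpa using hf)]

theorem Place.valuation_algebraMap_le_one (P : Place k F) (c : k) :
    (IsDiscreteValuationRing.maximalIdeal P.valuationRing).valuation F (algebraMap k F c) ≤ 1 := by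
  rw [IsScalarTower.algebraMap_apply k P.valuationRing F]
  exact IsDedekindDomain.HeightOneSpectrum.valuation_le_one _ _

/-- The Riemann–Roch space `ℒ(D) = {f ∈ F : f = 0 or v_P(f) ≥ -D(P) for all places P}`. -/
def riemannRochSpace (D : FunctionFieldDivisor k F) : Submodule k F where
  carrier := {f | f = 0 ∨ ∀ P : Place k F, -D P ≤ P.ord f}
  zero_mem' := Or.inl rfl
  add_mem' := by
    intro f g hf hg
    by_cases hf0 : f = 0
    · simpa [hf0] using hg
    by_cases hg0 : g = 0
    · simpa [hg0] using hf
    by_cases hfg : f + g = 0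
    · exact Or.inl hfg
    refine Or.inr fun P => (P.neg_le_ord_iff hfg _).mpr (Valuation.map_add_le _ ?_ ?_)
    · exact (P.neg_le_ord_iff hf0 _).mp (hf.resolve_left hf0 P)
    · exact (P.neg_le_ord_iff hg0 _).mp (hg.resolve_left hg0 P)
  smul_mem' := by
    intro c f hf
    by_cases hcf : c • f = 0
    · exact Or.inl hcf
    have hf0 : f ≠ 0 := fun h => hcf (by rw [h, smul_zero])
    refine Or.inr fun P => (P.neg_le_ord_iff hcf _).mpr ?_
    rw [Algebra.smul_def, map_mul]
    exact mul_le_of_le_one_of_le (P.valuation_algebraMap_le_one c)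
      ((P.neg_le_ord_iff hf0 _).mp (hf.resolve_left hf0 P))

end Divisors

/-! A nonzero `f` in both spaces has no poles: by disjointness each place `P` lies outside the
support of `D₁` or of `D₂`, and there the corresponding bound reads `v_P(f) ≥ 0`. So `f` lies in
every valuation ring of `F / k`, hence is algebraic over `k` by the lemma below, hence constant by
`hconst`. Conversely, a nonzero constant has order at least `0` everywhere, which effectivity makes
sufficient.

The lemma below rests on the fact that an integrally closed subring of a field is the intersection
of the valuation rings above it; no function field hypothesis is needed. -/

theorem isAlgebraic_of_forall_place_mem {k F : Type*} [Field k] [Field F] [Algebra k F] {f : F}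
    (hf : ∀ P : Place k F, f ∈ P.valuationRing) : IsAlgebraic k f := by
  by_contra h
  have hfR : f ∉ (integralClosure k F).toSubring := fun hmem => h (IsIntegral.isAlgebraic hmem)
  have : IsIntegrallyClosedIn (integralClosure k F).toSubring F :=
    inferInstanceAs (IsIntegrallyClosedIn (integralClosure k F) F)
  -- `V` contains the integral closure of `k`, hence `k`, but omits `f`. The omission also gives `V
  -- ≠ ⊤`, so `V` is a place, contradicting `hf`.
  obtain ⟨V, hV, hfV⟩ := Subring.exists_le_valuationSubring_of_isIntegrallyClosedIn hfR
  exact hfV (hf ⟨V, fun c => hV ((integralClosure k F).algebraMap_mem c),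
    fun htop => hfV (htop ▸ ValuationSubring.mem_top f)⟩)

/-- Links `ord`, defined by the adic valuation of the maximal ideal, back to the ring: in the
fraction field of a discrete valuation ring, elements of valuation at most `1` come from the ring.
-/
theorem Place.mem_valuationRing_of_ord_nonneg {k F : Type*} [Field k] [Field F] [Algebra k F]
    [IsAlgFunctionField k F] (P : Place k F) {f : F} (hf : f ≠ 0) (h : 0 ≤ P.ord f) :
    f ∈ P.valuationRing := by
  have h1 := (P.neg_le_ord_iff hf 0).mp (by simpa using h)
  obtain ⟨a, rfl⟩ := IsDiscreteValuationRing.exists_lift_of_le_one (by simpa using h1)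
  exact a.2

theorem algebraMap_mem_riemannRochSpace {k F : Type*} [Field k] [Field F] [Algebra k F]
    [IsAlgFunctionField k F] {D : FunctionFieldDivisor k F} (hD : 0 ≤ D) (c : k) :
    algebraMap k F c ∈ riemannRochSpace D := by
  by_cases hc : algebraMap k F c = 0
  · exact Or.inl hc
  · refine Or.inr fun P => (neg_nonpos.mpr (hD P)).trans ?_
    simpa using (P.neg_le_ord_iff hc 0).mpr (by simpa using P.valuation_algebraMap_le_one c)

theorem mainTheorem3 (k F : Type*) [Field k] [Finite k] [Field F] [Algebra k F]
    [IsAlgFunctionField k F]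
    (hconst : ∀ c : F, IsAlgebraic k c → c ∈ Set.range (algebraMap k F))
    (D₁ D₂ : FunctionFieldDivisor k F) (hD₁ : 0 ≤ D₁) (hD₂ : 0 ≤ D₂)
    (hdisj : Disjoint D₁.support D₂.support) :
    (riemannRochSpace D₁ : Set F) ∩ (riemannRochSpace D₂ : Set F) =
      Set.range (algebraMap k F) := by
  apply Set.Subset.antisymm
  · rintro f ⟨h₁, h₂⟩
    by_cases hf : f = 0
    · exact ⟨0, by rw [hf, map_zero]⟩
    refine hconst f (isAlgebraic_of_forall_place_mem fun P =>
      P.mem_valuationRing_of_ord_nonneg hf ?_)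
    -- At least one of `D₁ P`, `D₂ P` vanishes; use the space whose divisor does.
    by_cases hP : D₁ P = 0
    · simpa [hP] using h₁.resolve_left hf P
    · have hP₂ : D₂ P = 0 := Finsupp.notMem_support_iff.mp
        (Finset.disjoint_left.mp hdisj (Finsupp.mem_support_iff.mpr hP))
      simpa [hP₂] using h₂.resolve_left hf P
  · rintro _ ⟨c, rfl⟩
    exact ⟨algebraMap_mem_riemannRochSpace hD₁ c, algebraMap_mem_riemannRochSpace hD₂ c⟩
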